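/- **Riccati upper bounds.** Let $A\in\mathbb R^{n\times n}$, $B\in\mathbb R^{n\times p}$. Write $\mathcal C_k=[\,B\;\,AB\;\cdots\;A^{k-1}B\,]$ (with $\operatorname{rank}\mathcal C_0=0$). The pair $(A,B)$ is controllable if $\operatorname{rank}\mathcal C_k=n$ for some $k\le n$; its controllability index is $\kappa=\min\{k\ge 1:\operatorname{rank}\mathcal C_k=n\}$. Put $p_i=\operatorname{rank}\mathcal C_i-\operatorname{rank}\mathcal C_{i-1}$ for $1\le i\le\kappa$. A staircase form of a controllable pair is given by an orthogonal $U$ such that, in the partition of $\{1,\dots,n\}$ into consecutive blocks of sizes $p_1,\dots,p_\kappa$, only the first block $B_1$ of rows of $U'B$ is nonzero, and the blocks $A_{i,j}$ of $U'AU$ vanish for $i\ge j+2$ and have full row rank $p_{i}$ for $i=j+1$. For $\mu>0$ the pair is $\mu$-robustly coupled if it is controllable and, in a staircase form, $\sigma_p(B_1)\ge\mu$ and $\sigma_{p_{i+1}}(A_{i+1,i})\ge\mu$ for $1\le i\le\kappa-1$, where $\sigma_k$ is the $k$-th largest singular value. All norms are spectral norms. For every $c>1$ there is a real polynomial $F$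 in five variables, depending only on $c$, such that the following holds for all $n,p$, all $M\ge 1$, $\mu>0$, every controllable and $\mu$-robustly coupled pair $(A,B)$ with controllability index $\kappa$ and $\|A\|_2,\|B\|_2\le M$, every positive semidefinite $Q\in\mathbb R^{n\times n}$ and every positive definite $R\in\mathbb R^{p\times p}$. (1) If $\max\{M,M/\mu\}\ge c$, then for every $T>\kappa$ the solution of the Riccati difference equation $$P_{k-1}=A'P_kA+Q-A'P_kB(B'P_kB+R)^{-1}B'P_kA,\qquad P_T=Q,$$ satisfies $$\|P_0\|_2\le F\big((M/\mu)^{\kappa},\,M^{\kappa},\,\kappa,\,\|Q\|_2,\,\|R\|_2\big).$$ Moreover, if $Q\succ 0$, then the algebraic Riccati equation $$P=A'PA+Q-A'PB(B'PB+R)^{-1}B'PA$$ has a unique positive definite solution $P$, and $\|P\|_2$ satisfies the same bound. (2) Without the condition $\max\{M,M/\mu\}\ge c$, the same statements hold with the bound $$F\big((cM/\mu)^{\kappa},\,M^{\kappa},\,\kappa,\,\|Q\|_2,\,\|R\|_2\big).$$ -/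

import Mathlib

open scoped Matrix Matrix.Norms.L2Operator

noncomputable section

/-- The controllability matrix `[B, A B, …, A ^ (k - 1) B]`; its columns are indexed by pairs
(block number, column of `B`). -/
def controllabilityMatrix {n p : ℕ} (A : Matrix (Fin n) (Fin n) ℝ) (B : Matrix (Fin n) (Fin p) ℝ)
    (k : ℕ) : Matrix (Fin n) (Fin k × Fin p) ℝ :=
  Matrix.of fun i jc => (A ^ (jc.1 : ℕ) * B) i jc.2

/-- The rank of the controllability matrix with `k` blocks (`0` for `k = 0`). -/
def ctrbRank {n p : ℕ} (A : Matrix (Fin n) (Fin n) ℝ) (B : Matrix (Fin n) (Fin p) ℝ) (k : ℕ) : ℕ :=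
  (controllabilityMatrix A B k).rank

/-- `(A, B)` is controllable. -/
def IsControllablePair {n p : ℕ} (A : Matrix (Fin n) (Fin n) ℝ) (B : Matrix (Fin n) (Fin p) ℝ) :
    Prop :=
  ∃ k ≤ n, ctrbRank A B k = n

/-- The controllability index: the least `k ≥ 1` such that the controllability matrix with `k`
blocks has rank `n`. -/
def controllabilityIndex {n p : ℕ} (A : Matrix (Fin n) (Fin n) ℝ)
    (B : Matrix (Fin n) (Fin p) ℝ) : ℕ :=
  sInf {k : ℕ | 1 ≤ k ∧ ctrbRank A B k = n}

/-- Coordinate `r` belongs to the `i`-th block of the staircase partition (`i = 1, …, κ`). The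
`i`-th block consists of `p_i = rank C_i - rank C_{i-1}` consecutive coordinates. -/
abbrev InStairBlock {n p : ℕ} (A : Matrix (Fin n) (Fin n) ℝ) (B : Matrix (Fin n) (Fin p) ℝ)
    (i : ℕ) (r : Fin n) : Prop :=
  ctrbRank A B (i - 1) ≤ (r : ℕ) ∧ (r : ℕ) < ctrbRank A B i

/-- The size `p_i` of the `i`-th block. -/
def stairSize {n p : ℕ} (A : Matrix (Fin n) (Fin n) ℝ) (B : Matrix (Fin n) (Fin p) ℝ)
    (i : ℕ) : ℕ :=
  ctrbRank A B i - ctrbRank A B (i - 1)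

/-- The block `A_{i,j}` of `Uᵀ A U` in the staircase partition. -/
def stairBlockA {n p : ℕ} (A : Matrix (Fin n) (Fin n) ℝ) (B : Matrix (Fin n) (Fin p) ℝ)
    (U : Matrix (Fin n) (Fin n) ℝ) (i j : ℕ) :
    Matrix {r : Fin n // InStairBlock A B i r} {r : Fin n // InStairBlock A B j r} ℝ :=
  (Uᵀ * A * U).toBlock (InStairBlock A B i) (InStairBlock A B j)

/-- The `i`-th block of rows of `Uᵀ B` in the staircase partition; the first one is `B_1`. -/
def stairBlockB {n p : ℕ} (A : Matrix (Fin n) (Fin n) ℝ) (B : Matrix (Fin n) (Fin p) ℝ)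
    (U : Matrix (Fin n) (Fin n) ℝ) (i : ℕ) :
    Matrix {r : Fin n // InStairBlock A B i r} (Fin p) ℝ :=
  (Uᵀ * B).submatrix Subtype.val id

/-- The orthogonal matrix `U` brings `(A, B)` to staircase (block Hessenberg) form: only the first
block of `Uᵀ B` is nonzero, the blocks of `Uᵀ A U` below the first block subdiagonal vanish, and
the subdiagonal blocks have full row rank. -/
structure IsStaircaseTransform {n p : ℕ} (A : Matrix (Fin n) (Fin n) ℝ)
    (B : Matrix (Fin n) (Fin p) ℝ) (U : Matrix (Fin n) (Fin n) ℝ) : Prop where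
  orthogonal : U ∈ Matrix.orthogonalGroup (Fin n) ℝ
  inputBlocks : ∀ i, 2 ≤ i → stairBlockB A B U i = 0
  lowerBlocks : ∀ i j, j + 2 ≤ i → stairBlockA A B U i j = 0
  fullRowRank : ∀ i, 1 ≤ i → i + 1 ≤ controllabilityIndex A B →
    (stairBlockA A B U (i + 1) i).rank = stairSize A B (i + 1)

/-- The `k`-th largest singular value (`k = 1, 2, …`) of a real matrix. -/
def singularValue {m l : Type*} [Fintype m] [Fintype l] [DecidableEq l] (X : Matrix m l ℝ)
    (k : ℕ) : ℝ :=
  (Matrix.toEuclideanLin X).singularValues (k - 1)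

/-- `(A, B)` is `μ`-robustly coupled. The singular values that occur do not depend on the choice
of the staircase form. The condition on `B_1` forces `B` to have full column rank, so that `B_1`
is a square matrix. -/
def IsRobustlyCoupled {n p : ℕ} (A : Matrix (Fin n) (Fin n) ℝ) (B : Matrix (Fin n) (Fin p) ℝ)
    (μ : ℝ) : Prop :=
  0 < μ ∧ IsControllablePair A B ∧ ∃ U, IsStaircaseTransform A B U ∧
    μ ≤ singularValue (stairBlockB A B U 1) p ∧
    ∀ i, 1 ≤ i → i + 1 ≤ controllabilityIndex A B →
      μ ≤ singularValue (stairBlockA A B U (i + 1) i) (stairSize A B (i + 1))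

/-- The right-hand side of the Riccati equation. -/
def riccatiMap {n p : ℕ} (A : Matrix (Fin n) (Fin n) ℝ) (B : Matrix (Fin n) (Fin p) ℝ)
    (Q : Matrix (Fin n) (Fin n) ℝ) (R : Matrix (Fin p) (Fin p) ℝ)
    (P : Matrix (Fin n) (Fin n) ℝ) : Matrix (Fin n) (Fin n) ℝ :=
  Aᵀ * P * A + Q - Aᵀ * P * B * (Bᵀ * P * B + R)⁻¹ * Bᵀ * P * A

/-- `P_0, …, P_T` solves the Riccati difference equation with terminal condition `P_T = Q`. -/
def IsRiccatiDifferenceSolution {n p : ℕ} (A : Matrix (Fin n) (Fin n) ℝ)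
    (B : Matrix (Fin n) (Fin p) ℝ) (Q : Matrix (Fin n) (Fin n) ℝ) (R : Matrix (Fin p) (Fin p) ℝ)
    (T : ℕ) (P : ℕ → Matrix (Fin n) (Fin n) ℝ) : Prop :=
  P T = Q ∧ ∀ k, 1 ≤ k → k ≤ T → P (k - 1) = riccatiMap A B Q R (P k)

/-- `P` is a positive definite solution of the algebraic Riccati equation. -/
def IsPosDefRiccatiSolution {n p : ℕ} (A : Matrix (Fin n) (Fin n) ℝ)
    (B : Matrix (Fin n) (Fin p) ℝ) (Q : Matrix (Fin n) (Fin n) ℝ) (R : Matrix (Fin p) (Fin p) ℝ)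
    (P : Matrix (Fin n) (Fin n) ℝ) : Prop :=
  P.PosDef ∧ P = riccatiMap A B Q R P

/-- Both Riccati matrices are bounded by `b` in the spectral norm: `P_0` for every horizon `T > κ`
and, if `Q` is positive definite, the (existing and unique) positive definite solution of the
algebraic Riccati equation. -/
def RiccatiBoundedBy {n p : ℕ} (A : Matrix (Fin n) (Fin n) ℝ) (B : Matrix (Fin n) (Fin p) ℝ)
    (Q : Matrix (Fin n) (Fin n) ℝ) (R : Matrix (Fin p) (Fin p) ℝ) (κ : ℕ) (b : ℝ) : Prop :=
  (∀ T : ℕ, κ < T → ∀ P : ℕ → Matrix (Fin n) (Fin n) ℝ,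
      IsRiccatiDifferenceSolution A B Q R T P → ‖P 0‖ ≤ b) ∧
  (Q.PosDef → ∃ P : Matrix (Fin n) (Fin n) ℝ, IsPosDefRiccatiSolution A B Q R P ∧
      (∀ P', IsPosDefRiccatiSolution A B Q R P' → P' = P) ∧ ‖P‖ ≤ b)

end

/-!
The quadratic form of `P₀` at `x₀` is the optimal cost of a linear-quadratic regulator problem, so
it is at most the cost of any control that steers `x₀` to the origin. It therefore suffices to
steer `x₀` to the origin in `κ` steps along a trajectory whose norm is exponential in `κ`.

In staircase coordinates the `i`-th block of the state acts as a control on the blocks after it,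
through a coupling with a right inverse of norm at most `1 / μ`. Starting from the empty tail
after the last block, one extends a trajectory of the blocks after the `i`-th to one that includes
the `i`-th. The crucial point is to recover the `i`-th block at time `k` from the values of the
given trajectory at the times `k` and `k + 1` rather than through feedback gains: each extension
then multiplies the norm by at most `3 (M / μ) M`, whereas composing gains would give a bound
exponential in `κ ^ 2`. The constant `36 ^ κ` that remains is absorbed by a power of
`(M / μ) ^ κ * M ^ κ`, because `max M (M / μ) ≥ c > 1`.

The same bound holds for all iterates of the Riccati map from `Q`. They increase, so they
accumulate at a solution of the algebraic Riccati equation. Two positive definite solutions agree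
because the difference of their quadratic forms contracts along the closed loop of either one.
-/

section SingularValues

open scoped InnerProductSpace

variable {𝕜 E F : Type*} [RCLike 𝕜] [NormedAddCommGroup E] [InnerProductSpace 𝕜 E]
  [FiniteDimensional 𝕜 E] [NormedAddCommGroup F] [InnerProductSpace 𝕜 F] [FiniteDimensional 𝕜 F]

theorem norm_map_sq_eq_sum_sq_singularValues_mul (T : E →ₗ[𝕜] F) (x : E) :
    ‖T x‖ ^ 2 = ∑ i : Fin (Module.finrank 𝕜 E), T.singularValues i ^ 2 *
      ‖⟪T.isSymmetric_adjoint_comp_self.eigenvectorBasis rfl i, x⟫_𝕜‖ ^ 2 := by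
  have hS := T.isSymmetric_adjoint_comp_self
  set b := hS.eigenvectorBasis rfl
  have hterm : ∀ i, ⟪(T.adjoint ∘ₗ T) x, b i⟫_𝕜 * ⟪b i, x⟫_𝕜 =
      ((T.singularValues i ^ 2 * ‖⟪b i, x⟫_𝕜‖ ^ 2 : ℝ) : 𝕜) := fun i => by
    rw [hS, hS.apply_eigenvectorBasis, inner_smul_right, mul_assoc, ← inner_conj_symm x,
      RCLike.conj_mul, ← T.sq_singularValues_fin rfl]
    push_cast
    rfl
  have hsum : ((‖T x‖ ^ 2 : ℝ) : 𝕜) = ⟪(T.adjoint ∘ₗ T) x, x⟫_𝕜 := by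
    rw [LinearMap.comp_apply, LinearMap.adjoint_inner_left, inner_self_eq_norm_sq_to_K]
    push_cast
    rfl
  rw [← b.sum_inner_mul_inner, Finset.sum_congr rfl fun i _ => hterm i] at hsum
  exact_mod_cast hsum

theorem norm_map_eigenvectorBasis_eq_singularValues (T : E →ₗ[𝕜] F)
    (i : Fin (Module.finrank 𝕜 E)) :
    ‖T (T.isSymmetric_adjoint_comp_self.eigenvectorBasis rfl i)‖ = T.singularValues i := by
  rw [← sq_eq_sq₀ (norm_nonneg _) (T.singularValues_nonneg i),
    norm_map_sq_eq_sum_sq_singularValues_mul, Finset.sum_eq_single i]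
  · simp
  · intro j _ hji
    simp [OrthonormalBasis.inner_eq_zero _ hji]
  · simp

theorem singularValues_le_of_norm_map_le (T : E →ₗ[𝕜] F) {C : ℝ} (hC : 0 ≤ C)
    (hT : ∀ x, ‖T x‖ ≤ C * ‖x‖) (i : ℕ) : T.singularValues i ≤ C := by
  by_cases! hi : i < Module.finrank 𝕜 E
  · have h := hT (T.isSymmetric_adjoint_comp_self.eigenvectorBasis rfl ⟨i, hi⟩)
    rwa [norm_map_eigenvectorBasis_eq_singularValues, OrthonormalBasis.norm_eq_one,
      mul_one] at h
  · rwa [T.singularValues_of_finrank_le hi]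

theorem mul_norm_le_norm_map_of_mem_ker_orthogonal (T : E →ₗ[𝕜] F) {μ : ℝ} (hμ : 0 ≤ μ)
    (hT : ∀ i, 0 < T.singularValues i → μ ≤ T.singularValues i) {x : E} (hx : x ∈ T.kerᗮ) :
    μ * ‖x‖ ≤ ‖T x‖ := by
  rw [← sq_le_sq₀ (by positivity) (norm_nonneg _), mul_pow,
    norm_map_sq_eq_sum_sq_singularValues_mul]
  set b := T.isSymmetric_adjoint_comp_self.eigenvectorBasis rfl
  rw [← b.sum_sq_norm_inner_right x, Finset.mul_sum]
  refine Finset.sum_le_sum fun i _ => ?_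
  rcases (T.singularValues_nonneg i).eq_or_lt with hi | hi
  · have hker : b i ∈ T.ker := by
      rw [LinearMap.mem_ker, ← norm_eq_zero, norm_map_eigenvectorBasis_eq_singularValues, ← hi]
    rw [Submodule.inner_right_of_mem_orthogonal hker hx]
    simp
  · have := hT i hi
    gcongr

theorem exists_preimage_mul_norm_le (T : E →ₗ[𝕜] F) {μ : ℝ} (hμ : 0 < μ)
    (hT : ∀ i < Module.finrank 𝕜 F, μ ≤ T.singularValues i) (y : F) :
    ∃ x, T x = y ∧ μ * ‖x‖ ≤ ‖y‖ := by
  have hrank : Module.finrank 𝕜 T.range = Module.finrank 𝕜 F := by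
    refine (Submodule.finrank_le _).antisymm (not_lt.mp fun hlt => ?_)
    exact (T.singularValues_finrank_range_self ▸ hT _ hlt).not_gt hμ
  obtain ⟨x, rfl⟩ : y ∈ T.range := by
    rw [Submodule.eq_top_of_finrank_eq hrank]
    exact Submodule.mem_top
  obtain ⟨k, hk, z, hz, rfl⟩ := T.ker.exists_add_mem_mem_orthogonal x
  refine ⟨z, by simp [LinearMap.mem_ker.mp hk], ?_⟩
  rw [map_add, LinearMap.mem_ker.mp hk, zero_add]
  refine mul_norm_le_norm_map_of_mem_ker_orthogonal T hμ.le (fun i hi => hT i ?_) hz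
  exact hrank ▸ T.singularValues_pos_iff_lt_finrank_range.mp hi

section Matrix

variable {m l : Type*} [Fintype m] [Fintype l] [DecidableEq l]

theorem norm_toEuclideanLin_le (X : Matrix m l ℝ) (x : EuclideanSpace ℝ l) :
    ‖X.toEuclideanLin x‖ ≤ ‖X‖ * ‖x‖ :=
  X.l2_opNorm_mulVec x

theorem exists_toEuclideanLin_preimage_mul_norm_le (X : Matrix m l ℝ) {μ : ℝ} (hμ : 0 < μ) {k : ℕ}
    (hk : Fintype.card m ≤ k) (hX : μ ≤ singularValue X k) (y : EuclideanSpace ℝ m) :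
    ∃ x, X.toEuclideanLin x = y ∧ μ * ‖x‖ ≤ ‖y‖ := by
  refine exists_preimage_mul_norm_le _ hμ (fun i hi => hX.trans ?_) y
  rw [finrank_euclideanSpace] at hi
  exact X.toEuclideanLin.singularValues_antitone (by lia)

end Matrix

end SingularValues

section Deadbeat

theorem norm_le_of_mul_norm_sub_le {E : Type*} [SeminormedAddCommGroup E] {M μ S : ℝ} (hμ : 0 < μ)
    (hμM : μ ≤ M) (hM : 1 ≤ M) {y w w' : E} (hw : ‖w‖ ≤ S) (hw' : ‖w'‖ ≤ S)
    (hy : μ * ‖y - w‖ ≤ ‖w'‖ + M * ‖w‖) :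
    ‖y‖ ≤ 3 * (M / μ) * S := by
  have hS : 0 ≤ S := (norm_nonneg w).trans hw
  have hyw : ‖y - w‖ ≤ (S + M * S) / μ := by
    rw [le_div_iff₀' hμ]
    exact hy.trans (add_le_add hw' (by gcongr))
  calc ‖y‖ ≤ ‖w‖ + ‖y - w‖ := norm_le_norm_add_norm_sub' _ _
    _ ≤ M / μ * S + (M * S + M * S) / μ := by
      gcongr
      · exact hw.trans (le_mul_of_one_le_left hS ((one_le_div hμ).mpr hμM))
      · exact hyw.trans (by gcongr; exact le_mul_of_one_le_left hS hM)
    _ = 3 * (M / μ) * S := by ring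

variable {R E F : Type*} [Ring R] [NormedAddCommGroup E] [Module R E] [NormedAddCommGroup F]
  [Module R F]

/-- Deadbeat control with gain `W`: every initial state of `x (k + 1) = A (x k) + B (u k)` can be
steered to the origin in `κ` steps, and kept there, by controls such that neither they nor the
states exceed `W` times the norm of the initial state. -/
def HasDeadbeatControl (A : E →ₗ[R] E) (B : F →ₗ[R] E) (κ : ℕ) (W : ℝ) : Prop :=
  ∀ x₀, ∃ (x : ℕ → E) (u : ℕ → F), x 0 = x₀ ∧ (∀ k, x (k + 1) = A (x k) + B (u k)) ∧
    (∀ k, κ ≤ k → x k = 0 ∧ u k = 0) ∧ ∀ k, ‖x k‖ ≤ W * ‖x₀‖ ∧ ‖u k‖ ≤ W * ‖x₀‖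

theorem HasDeadbeatControl.of_linearIsometryEquiv {A : E →ₗ[R] E} {B : F →ₗ[R] E} {E' : Type*}
    [NormedAddCommGroup E'] [Module R E'] {A' : E' →ₗ[R] E'} {B' : F →ₗ[R] E'} {κ : ℕ} {W : ℝ}
    (h : HasDeadbeatControl A' B' κ W) (e : E ≃ₗᵢ[R] E') (hA : ∀ x, e (A x) = A' (e x))
    (hB : ∀ u, e (B u) = B' u) :
    HasDeadbeatControl A B κ W := by
  intro x₀
  obtain ⟨x, u, hx₀, hx, hzero, hnorm⟩ := h (e x₀)
  simp only [e.norm_map] at hnorm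
  refine ⟨fun k => e.symm (x k), u, e.symm_apply_eq.mpr hx₀, fun k => e.symm_apply_eq.mpr ?_,
    fun k hk => ⟨e.symm_apply_eq.mpr ((hzero k hk).1.trans (map_zero e).symm), (hzero k hk).2⟩,
    fun k => ⟨(e.symm.norm_map _).trans_le (hnorm k).1, (hnorm k).2⟩⟩
  rw [hx, map_add, hA, hB, e.apply_symm_apply]

/-- A decreasing chain of `κ` contractive projections `π i`, the kernels of `π (i + 1)` in the
range of `π i` being the blocks of a staircase form: block `i + 1` acts on block `i + 2` through a
map with a right inverse of norm at most `μ⁻¹`, and so does the input on block `1`. -/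
structure IsCoupledFlag (A : E →ₗ[R] E) (B : F →ₗ[R] E) (π : ℕ → E →ₗ[R] E) (κ : ℕ) (μ : ℝ) :
    Prop where
  apply_zero : π 0 = LinearMap.id
  apply_index : π κ = 0
  apply_apply : ∀ i j x, π i (π j x) = π (max i j) x
  norm_apply_le : ∀ i x, ‖π i x‖ ≤ ‖x‖
  exists_coupling : ∀ i d, π (i + 1) d = d → π (i + 2) d = 0 →
    ∃ v, π i v = v ∧ π (i + 1) v = 0 ∧ π (i + 1) (A v) = d ∧ μ * ‖v‖ ≤ ‖d‖
  exists_input : ∀ d, π 1 d = 0 → ∃ u, B u = d ∧ μ * ‖u‖ ≤ ‖d‖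

/-- A sequence in the range of `π i` that obeys the dynamics `y (k + 1) = A (y k)` after block
`i + 1`, in which it is unconstrained: block `i + 1` serves as a virtual control. -/
structure IsTailTrajectory (A : E →ₗ[R] E) (π : ℕ → E →ₗ[R] E) (i : ℕ) (y : ℕ → E) : Prop where
  map_eq : ∀ k, π i (y k) = y k
  map_succ : ∀ k, π (i + 1) (y (k + 1)) = π (i + 1) (A (y k))

namespace IsCoupledFlag

variable {A : E →ₗ[R] E} {B : F →ₗ[R] E} {π : ℕ → E →ₗ[R] E} {κ i : ℕ} {M μ : ℝ}

theorem exists_virtual_control (hπ : IsCoupledFlag A B π κ μ) (hA : ∀ x, ‖A x‖ ≤ M * ‖x‖)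
    {w : ℕ → E} (hw : IsTailTrajectory A π (i + 1) w) (k : ℕ) :
    ∃ v, π i v = v ∧ π (i + 1) v = 0 ∧ π (i + 1) (A (w k + v)) = w (k + 1) ∧
      μ * ‖v‖ ≤ ‖w (k + 1)‖ + M * ‖w k‖ := by
  obtain ⟨v, hv, hv_succ, hAv, hv_norm⟩ := hπ.exists_coupling i
    (w (k + 1) - π (i + 1) (A (w k)))
    (by rw [map_sub, hw.map_eq, hπ.apply_apply, max_self])
    (by rw [map_sub, hπ.apply_apply, max_eq_left (Nat.le_succ _), hw.map_succ, sub_self])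
  refine ⟨v, hv, hv_succ, by rw [map_add, map_add, hAv, add_sub_cancel], hv_norm.trans ?_⟩
  exact (norm_sub_le _ _).trans (add_le_add_right ((hπ.norm_apply_le _ _).trans (hA _)) _)

theorem exists_tailTrajectory_extension (hπ : IsCoupledFlag A B π κ μ)
    (hA : ∀ x, ‖A x‖ ≤ M * ‖x‖) {w : ℕ → E} (hw : IsTailTrajectory A π (i + 1) w) {y₀ : E}
    (hy₀ : π i y₀ = y₀) (hw₀ : w 0 = π (i + 1) (A y₀)) :
    ∃ y, y 0 = y₀ ∧ IsTailTrajectory A π i y ∧ ∀ k,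
      μ * ‖y (k + 1) - w k‖ ≤ ‖w (k + 1)‖ + M * ‖w k‖ := by
  choose v hv hv_succ hAv hv_norm using hπ.exists_virtual_control hA hw
  have hproj : ∀ k, π (i + 1) (w k + v k) = w k := fun k => by
    rw [map_add, hw.map_eq, hv_succ, add_zero]
  have hw_mem : ∀ k, π i (w k) = w k := fun k => by
    rw [← hw.map_eq k, hπ.apply_apply, max_eq_right (Nat.le_succ i)]
  refine ⟨fun | 0 => y₀ | k + 1 => w k + v k, rfl, ⟨?_, ?_⟩, fun k => by simpa using hv_norm k⟩
  · rintro (_ | k)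
    · exact hy₀
    · change π i (w k + v k) = w k + v k
      rw [map_add, hv, hw_mem]
  · rintro (_ | k)
    · exact (hproj 0).trans hw₀
    · exact (hproj (k + 1)).trans (hAv k).symm

theorem exists_tailTrajectory_of_add_eq (hπ : IsCoupledFlag A B π κ μ) (hμ : 0 < μ)
    (hμM : μ ≤ M) (hM : 1 ≤ M) (hA : ∀ x, ‖A x‖ ≤ M * ‖x‖) {j : ℕ} (hij : i + j = κ) {y₀ : E}
    (hy₀ : π i y₀ = y₀) :
    ∃ y, y 0 = y₀ ∧ IsTailTrajectory A π i y ∧ (∀ k, j ≤ k → y k = 0) ∧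
      ∀ k, ‖y k‖ ≤ (3 * (M / μ) * M) ^ j * ‖y₀‖ := by
  have : 0 < M := hμ.trans_le hμM
  have hr : 1 ≤ M / μ := (one_le_div hμ).mpr hμM
  induction j generalizing i y₀ with
  | zero =>
    obtain rfl : y₀ = 0 := by rw [← hy₀, ← add_zero i, hij, hπ.apply_index, LinearMap.zero_apply]
    exact ⟨0, rfl, ⟨by simp, by simp⟩, by simp, by simp⟩
  | succ j ih =>
    obtain ⟨w, hw₀, hw, hw_zero, hw_norm⟩ := ih (i := i + 1) (by lia)
      (y₀ := π (i + 1) (A y₀)) (by rw [hπ.apply_apply, max_self])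
    obtain ⟨y, hy_zero, hy, hyw⟩ := hπ.exists_tailTrajectory_extension hA hw hy₀ hw₀
    set S := (3 * (M / μ) * M) ^ j * (M * ‖y₀‖)
    have hwS : ∀ k, ‖w k‖ ≤ S := fun k => (hw_norm k).trans <|
      mul_le_mul_of_nonneg_left ((hπ.norm_apply_le _ _).trans (hA y₀)) (by positivity)
    refine ⟨y, hy_zero, hy, ?_, ?_⟩
    · rintro (_ | k) hk
      · lia
      · have := hyw k
        simp only [hw_zero k (by lia), hw_zero (k + 1) (by lia), norm_zero, mul_zero, add_zero,
          sub_zero] at this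
        exact norm_le_zero_iff.mp (nonpos_of_mul_nonpos_right this hμ)
    · rintro (_ | k)
      · rw [hy_zero]
        refine le_mul_of_one_le_left (norm_nonneg _) (one_le_pow₀ ?_)
        nlinarith
      · exact (norm_le_of_mul_norm_sub_le hμ hμM hM (hwS k) (hwS (k + 1)) (hyw k)).trans_eq
          (by ring)

theorem hasDeadbeatControl (hπ : IsCoupledFlag A B π κ μ) (hμ : 0 < μ)
    (hμM : μ ≤ M) (hM : 1 ≤ M) (hA : ∀ x, ‖A x‖ ≤ M * ‖x‖) :
    HasDeadbeatControl A B κ (2 * (M / μ) * (3 * (M / μ) * M) ^ κ) := by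
  intro x₀
  have : 0 < M := hμ.trans_le hμM
  have hr : 1 ≤ M / μ := (one_le_div hμ).mpr hμM
  have hx₀_mem : π 0 x₀ = x₀ := by rw [hπ.apply_zero, LinearMap.id_apply]
  obtain ⟨x, hx₀, hx, hx_zero, hx_norm⟩ :=
    hπ.exists_tailTrajectory_of_add_eq hμ hμM hM hA (zero_add κ) hx₀_mem
  choose u hBu hu_norm using fun k => hπ.exists_input (x (k + 1) - A (x k))
    (by rw [map_sub, sub_eq_zero]; exact hx.map_succ k)
  set S := (3 * (M / μ) * M) ^ κ * ‖x₀‖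
  have hS : 0 ≤ S := by positivity
  refine ⟨x, u, hx₀, fun k => by rw [hBu, add_sub_cancel], fun k hk => ⟨hx_zero k hk, ?_⟩,
    fun k => ⟨(hx_norm k).trans ?_, ?_⟩⟩
  · have := hu_norm k
    rw [hx_zero k hk, hx_zero (k + 1) (by lia), map_zero, sub_zero, norm_zero] at this
    exact norm_le_zero_iff.mp (nonpos_of_mul_nonpos_right this hμ)
  · rw [mul_assoc]
    exact le_mul_of_one_le_left hS (by linarith)
  · refine le_of_mul_le_mul_left ((hu_norm k).trans ?_) hμ
    calc ‖x (k + 1) - A (x k)‖ ≤ S + M * S :=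
          (norm_sub_le _ _).trans
            (add_le_add (hx_norm _) ((hA _).trans (by gcongr; exact hx_norm k)))
      _ ≤ M * S + M * S := by gcongr; exact le_mul_of_one_le_left hS hM
      _ = _ := by field_simp; ring

end IsCoupledFlag

end Deadbeat

section Submatrix

variable {m l m' l' : Type*} [Fintype l] [Fintype l']

theorem norm_toLp_comp_eq {f : l' → l} (hf : f.Injective) {v : EuclideanSpace ℝ l}
    (hv : ∀ j ∉ Set.range f, v j = 0) : ‖WithLp.toLp 2 (v ∘ f)‖ = ‖v‖ := by
  rw [EuclideanSpace.norm_eq, EuclideanSpace.norm_eq]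
  congr 1
  exact Fintype.sum_of_injective f hf _ _ (fun j hj => by simp [hv j hj]) fun _ => rfl

theorem norm_toLp_comp_le {f : l' → l} (hf : f.Injective) (v : EuclideanSpace ℝ l) :
    ‖WithLp.toLp 2 (v ∘ f)‖ ≤ ‖v‖ := by
  rw [EuclideanSpace.norm_eq, EuclideanSpace.norm_eq]
  refine Real.sqrt_le_sqrt ?_
  exact (Finset.sum_map Finset.univ ⟨f, hf⟩ fun j => ‖v j‖ ^ 2).symm.trans_le
    (Finset.sum_le_univ_sum_of_nonneg fun _ => sq_nonneg _)

variable [DecidableEq l]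

theorem toEuclideanLin_submatrix_apply [DecidableEq l'] (X : Matrix m l ℝ) (f : m' → m)
    {g : l' → l} (hg : g.Injective) {v : EuclideanSpace ℝ l} (hv : ∀ j ∉ Set.range g, v j = 0)
    (i : m') :
    (X.submatrix f g).toEuclideanLin (WithLp.toLp 2 (v ∘ g)) i = X.toEuclideanLin v (f i) := by
  simp only [Matrix.toLpLin_apply, Matrix.mulVec, dotProduct, Matrix.submatrix_apply]
  exact Fintype.sum_of_injective g hg _ _ (fun j hj => by rw [hv j hj, mul_zero]) fun _ => rfl

variable [Fintype m] [Fintype m']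

theorem singularValue_submatrix_id_le_norm (X : Matrix m l ℝ) {f : m' → m} (hf : f.Injective)
    (k : ℕ) : singularValue (X.submatrix f id) k ≤ ‖X‖ :=
  singularValues_le_of_norm_map_le _ (norm_nonneg X)
    (fun x => (norm_toLp_comp_le hf (X.toEuclideanLin x)).trans (norm_toEuclideanLin_le X x)) _

theorem exists_toEuclideanLin_apply_eq_of_submatrix [DecidableEq l'] (X : Matrix m l ℝ)
    {f : m' → m} {g : l' → l} (hf : f.Injective) (hg : g.Injective) {μ : ℝ} (hμ : 0 < μ)
    {k : ℕ} (hk : Fintype.card m' ≤ k) (hX : μ ≤ singularValue (X.submatrix f g) k)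
    (d : EuclideanSpace ℝ m) :
    ∃ v : EuclideanSpace ℝ l, (∀ j ∉ Set.range g, v j = 0) ∧
      (∀ i, X.toEuclideanLin v (f i) = d (f i)) ∧ μ * ‖v‖ ≤ ‖d‖ := by
  obtain ⟨y, hy, hy_norm⟩ :=
    exists_toEuclideanLin_preimage_mul_norm_le _ hμ hk hX (WithLp.toLp 2 (d ∘ f))
  set v : EuclideanSpace ℝ l := WithLp.toLp 2 (g.extend y 0)
  have hv : ∀ j ∉ Set.range g, v j = 0 := fun j hj => Function.extend_apply' _ _ _ hj
  have hvy : WithLp.toLp 2 (v ∘ g) = y := PiLp.ext fun i => hg.extend_apply _ _ i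
  refine ⟨v, hv, fun i => ?_, ?_⟩
  · rw [← toEuclideanLin_submatrix_apply X f hg hv, hvy, hy]
    rfl
  · rw [← norm_toLp_comp_eq hg hv, hvy]
    exact hy_norm.trans (norm_toLp_comp_le hf d)

end Submatrix

section TailProjection

variable {n : ℕ}

/-- The orthogonal projection of `ℝⁿ` onto the coordinates from position `t` on, the positions
being counted from `0`. -/
noncomputable def tailProj (n t : ℕ) : EuclideanSpace ℝ (Fin n) →ₗ[ℝ] EuclideanSpace ℝ (Fin n) :=
  (Matrix.diagonal fun r : Fin n => if t ≤ r then 1 else 0).toEuclideanLin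

theorem tailProj_apply (t : ℕ) (x : EuclideanSpace ℝ (Fin n)) (r : Fin n) :
    tailProj n t x r = if t ≤ r then x r else 0 := by
  simp [tailProj, Matrix.toLpLin_apply, Matrix.mulVec_diagonal]

theorem tailProj_eq_self_iff {t : ℕ} {x : EuclideanSpace ℝ (Fin n)} :
    tailProj n t x = x ↔ ∀ r : Fin n, (r : ℕ) < t → x r = 0 := by
  simp only [PiLp.ext_iff, tailProj_apply, ite_eq_left_iff, not_le, eq_comm (a := (0 : ℝ))]

theorem tailProj_eq_zero_iff {t : ℕ} {x : EuclideanSpace ℝ (Fin n)} :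
    tailProj n t x = 0 ↔ ∀ r : Fin n, t ≤ r → x r = 0 := by
  simp only [PiLp.ext_iff, tailProj_apply, PiLp.zero_apply, ite_eq_right_iff]

theorem tailProj_tailProj (s t : ℕ) (x : EuclideanSpace ℝ (Fin n)) :
    tailProj n s (tailProj n t x) = tailProj n (max s t) x := by
  ext r
  simp only [tailProj_apply, max_le_iff, ite_and]

theorem norm_tailProj_le (t : ℕ) (x : EuclideanSpace ℝ (Fin n)) : ‖tailProj n t x‖ ≤ ‖x‖ := by
  rw [EuclideanSpace.norm_eq, EuclideanSpace.norm_eq]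
  gcongr with r
  rw [tailProj_apply]
  split_ifs
  · rfl
  · rw [norm_zero]; positivity

end TailProjection

section Staircase

variable {n p : ℕ} (A : Matrix (Fin n) (Fin n) ℝ) (B : Matrix (Fin n) (Fin p) ℝ)

theorem ctrbRank_zero : ctrbRank A B 0 = 0 := by
  simpa [ctrbRank] using (controllabilityMatrix A B 0).rank_le_card_width

theorem ctrbRank_le (k : ℕ) : ctrbRank A B k ≤ n := by
  simpa [ctrbRank] using (controllabilityMatrix A B k).rank_le_card_height

theorem ctrbRank_one_le : ctrbRank A B 1 ≤ p := by
  simpa [ctrbRank] using (controllabilityMatrix A B 1).rank_le_card_width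

theorem ctrbRank_mono : Monotone (ctrbRank A B) := by
  refine monotone_nat_of_le_succ fun k => ?_
  rw [ctrbRank, ctrbRank, Matrix.rank_eq_finrank_span_cols, Matrix.rank_eq_finrank_span_cols]
  refine Submodule.finrank_mono (Submodule.span_mono ?_)
  rintro _ ⟨⟨j, c⟩, rfl⟩
  exact ⟨⟨j.castSucc, c⟩, rfl⟩

theorem card_inStairBlock_le (i : ℕ) :
    Fintype.card {r : Fin n // InStairBlock A B i r} ≤ stairSize A B i := by
  rw [← Fintype.card_fin (stairSize A B i)]
  refine Fintype.card_le_of_injective (fun r => ⟨(r.1 : ℕ) - ctrbRank A B (i - 1), ?_⟩) ?_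
  · have := r.2
    rw [stairSize]
    lia
  · rintro ⟨r, hr⟩ ⟨s, hs⟩ h
    simp only [Fin.mk.injEq] at h
    simp only [Subtype.mk.injEq, Fin.ext_iff]
    lia

variable {A B}

theorem controllabilityIndex_mem (h : IsControllablePair A B) :
    controllabilityIndex A B ∈ {k | 1 ≤ k ∧ ctrbRank A B k = n} := by
  obtain ⟨k, -, hk⟩ := h
  exact Nat.sInf_mem ⟨k + 1, k.succ_pos,
    (ctrbRank_le A B _).antisymm (hk.symm.trans_le (ctrbRank_mono A B k.le_succ))⟩

theorem ctrbRank_eq_of_controllabilityIndex_le (h : IsControllablePair A B) {k : ℕ}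
    (hk : controllabilityIndex A B ≤ k) : ctrbRank A B k = n :=
  (ctrbRank_le A B k).antisymm
    ((controllabilityIndex_mem h).2.symm.trans_le (ctrbRank_mono A B hk))

theorem exists_inStairBlock (h : IsControllablePair A B) (r : Fin n) :
    ∃ i, 1 ≤ i ∧ InStairBlock A B i r := by
  have hex : ∃ k, (r : ℕ) < ctrbRank A B k :=
    ⟨_, r.2.trans_eq (ctrbRank_eq_of_controllabilityIndex_le h le_rfl).symm⟩
  classical
  have hpos : Nat.find hex ≠ 0 := fun h₀ => by
    have := Nat.find_spec hex
    rw [h₀, ctrbRank_zero] at this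
    lia
  exact ⟨Nat.find hex, by lia, not_lt.mp (Nat.find_min hex (by lia)), Nat.find_spec hex⟩

theorem InStairBlock.lt_of_le {i I : ℕ} {r : Fin n} (h : InStairBlock A B I r)
    (hr : ctrbRank A B i ≤ r) : i < I :=
  (ctrbRank_mono A B).reflect_lt (hr.trans_lt h.2)

theorem InStairBlock.le_of_lt {j J : ℕ} {s : Fin n} (h : InStairBlock A B J s)
    (hs : (s : ℕ) < ctrbRank A B j) : J ≤ j :=
  Nat.le_of_pred_lt ((ctrbRank_mono A B).reflect_lt (h.1.trans_lt hs))

namespace IsStaircaseTransform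

variable {U : Matrix (Fin n) (Fin n) ℝ}

theorem lower_eq_zero (hU : IsStaircaseTransform A B U) (hc : IsControllablePair A B) {i : ℕ}
    {r s : Fin n} (hr : ctrbRank A B (i + 1) ≤ r) (hs : (s : ℕ) < ctrbRank A B i) :
    (Uᵀ * A * U) r s = 0 := by
  obtain ⟨I, -, hI⟩ := exists_inStairBlock hc r
  obtain ⟨J, -, hJ⟩ := exists_inStairBlock hc s
  have hIJ : J + 2 ≤ I := by
    have := hI.lt_of_le hr
    have := hJ.le_of_lt hs
    lia
  exact congrFun₂ (hU.lowerBlocks I J hIJ) ⟨r, hI⟩ ⟨s, hJ⟩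

theorem input_eq_zero (hU : IsStaircaseTransform A B U) (hc : IsControllablePair A B)
    {r : Fin n} (hr : ctrbRank A B 1 ≤ r) (s : Fin p) : (Uᵀ * B) r s = 0 := by
  obtain ⟨I, -, hI⟩ := exists_inStairBlock hc r
  exact congrFun₂ (hU.inputBlocks I (hI.lt_of_le hr)) ⟨r, hI⟩ s

theorem exists_coupling (hU : IsStaircaseTransform A B U) (hc : IsControllablePair A B) {μ : ℝ}
    (hμ : 0 < μ) {i : ℕ}
    (hi : μ ≤ singularValue (stairBlockA A B U (i + 2) (i + 1)) (stairSize A B (i + 2)))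
    {d : EuclideanSpace ℝ (Fin n)} (hd : tailProj n (ctrbRank A B (i + 1)) d = d)
    (hd' : tailProj n (ctrbRank A B (i + 2)) d = 0) :
    ∃ v, tailProj n (ctrbRank A B i) v = v ∧ tailProj n (ctrbRank A B (i + 1)) v = 0 ∧
      tailProj n (ctrbRank A B (i + 1)) ((Uᵀ * A * U).toEuclideanLin v) = d ∧
        μ * ‖v‖ ≤ ‖d‖ := by
  obtain ⟨v, hv, hAv, hv_norm⟩ := exists_toEuclideanLin_apply_eq_of_submatrix (Uᵀ * A * U)
    Subtype.val_injective Subtype.val_injective hμ (card_inStairBlock_le A B (i + 2)) hi d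
  have hv_block : ∀ r : Fin n, ¬ InStairBlock A B (i + 1) r → v r = 0 := fun r hr =>
    hv r fun ⟨r', hr'⟩ => hr (hr' ▸ r'.2)
  have hv_ge : ∀ r : Fin n, ctrbRank A B (i + 1) ≤ r → v r = 0 := fun r hr =>
    hv_block r fun h => hr.not_gt h.2
  rw [tailProj_eq_self_iff] at hd
  rw [tailProj_eq_zero_iff] at hd'
  refine ⟨v, tailProj_eq_self_iff.mpr fun r hr => hv_block r fun h => hr.not_ge h.1,
    tailProj_eq_zero_iff.mpr hv_ge, PiLp.ext fun r => ?_, hv_norm⟩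
  rw [tailProj_apply]
  split_ifs with hr
  · by_cases! hr' : (r : ℕ) < ctrbRank A B (i + 2)
    · exact hAv ⟨r, hr, hr'⟩
    · rw [hd' r hr']
      simp only [Matrix.toLpLin_apply, Matrix.mulVec, dotProduct]
      refine Finset.sum_eq_zero fun s _ => ?_
      by_cases! hs : (s : ℕ) < ctrbRank A B (i + 1)
      · exact mul_eq_zero_of_left (hU.lower_eq_zero hc hr' hs) _
      · exact mul_eq_zero_of_right _ (hv_ge s hs)
  · exact (hd r (not_le.mp hr)).symm

theorem exists_input (hU : IsStaircaseTransform A B U) (hc : IsControllablePair A B) {μ : ℝ}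
    (hμ : 0 < μ) (hB : μ ≤ singularValue (stairBlockB A B U 1) p)
    {d : EuclideanSpace ℝ (Fin n)} (hd : tailProj n (ctrbRank A B 1) d = 0) :
    ∃ u, (Uᵀ * B).toEuclideanLin u = d ∧ μ * ‖u‖ ≤ ‖d‖ := by
  have hcard : Fintype.card {r : Fin n // InStairBlock A B 1 r} ≤ p :=
    (card_inStairBlock_le A B 1).trans ((Nat.sub_le _ _).trans (ctrbRank_one_le A B))
  obtain ⟨u, -, hBu, hu⟩ := exists_toEuclideanLin_apply_eq_of_submatrix (Uᵀ * B)
    Subtype.val_injective Function.injective_id hμ hcard hB d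
  refine ⟨u, PiLp.ext fun r => ?_, hu⟩
  by_cases! hr : (r : ℕ) < ctrbRank A B 1
  · exact hBu ⟨r, (ctrbRank_zero A B).trans_le r.val.zero_le, hr⟩
  · rw [tailProj_eq_zero_iff.mp hd r hr]
    simp only [Matrix.toLpLin_apply, Matrix.mulVec, dotProduct]
    exact Finset.sum_eq_zero fun s _ => mul_eq_zero_of_left (hU.input_eq_zero hc hr s) _

theorem isCoupledFlag (hU : IsStaircaseTransform A B U) (hc : IsControllablePair A B) {μ : ℝ}
    (hμ : 0 < μ) (hB : μ ≤ singularValue (stairBlockB A B U 1) p)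
    (hA : ∀ i, 1 ≤ i → i + 1 ≤ controllabilityIndex A B →
      μ ≤ singularValue (stairBlockA A B U (i + 1) i) (stairSize A B (i + 1))) :
    IsCoupledFlag (Uᵀ * A * U).toEuclideanLin (Uᵀ * B).toEuclideanLin
      (fun i => tailProj n (ctrbRank A B i)) (controllabilityIndex A B) μ where
  apply_zero := LinearMap.ext fun x => tailProj_eq_self_iff.mpr fun r hr =>
    absurd hr (by rw [ctrbRank_zero]; exact r.val.not_lt_zero)
  apply_index := LinearMap.ext fun x => tailProj_eq_zero_iff.mpr fun r hr =>
    absurd r.2 ((ctrbRank_eq_of_controllabilityIndex_le hc le_rfl).symm.trans_le hr).not_gt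
  apply_apply i j x := by rw [tailProj_tailProj, ← (ctrbRank_mono A B).map_max]
  norm_apply_le i := norm_tailProj_le _
  exists_coupling i d hd hd' := by
    by_cases! hi : i + 2 ≤ controllabilityIndex A B
    · exact hU.exists_coupling hc hμ (hA (i + 1) i.succ_pos hi) hd hd'
    · have hrank : ctrbRank A B (i + 1) = n :=
        ctrbRank_eq_of_controllabilityIndex_le hc (Nat.lt_succ_iff.mp hi)
      obtain rfl : d = 0 := by
        ext r
        exact tailProj_eq_self_iff.mp hd r (r.2.trans_eq hrank.symm)
      exact ⟨0, by simp⟩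
  exists_input d hd := hU.exists_input hc hμ hB hd

end IsStaircaseTransform

end Staircase

section LoewnerOrder

open Matrix

open scoped MatrixOrder

variable {m : Type*} [Fintype m]

theorem le_iff_dotProduct_mulVec_le {X Y : Matrix m m ℝ} (hX : X.IsHermitian)
    (hY : Y.IsHermitian) : X ≤ Y ↔ ∀ x, x ⬝ᵥ X *ᵥ x ≤ x ⬝ᵥ Y *ᵥ x := by
  rw [Matrix.le_iff, posSemidef_iff_dotProduct_mulVec, and_iff_right (hY.sub hX)]
  simp [sub_mulVec]

theorem dotProduct_mulVec_mono {X Y : Matrix m m ℝ} (h : X ≤ Y) (x : m → ℝ) :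
    x ⬝ᵥ X *ᵥ x ≤ x ⬝ᵥ Y *ᵥ x := by
  simpa [sub_mulVec] using (Matrix.le_iff.mp h).dotProduct_mulVec_nonneg x

theorem isClosed_setOf_posSemidef {m : Type*} [Finite m] :
    IsClosed {X : Matrix m m ℝ | X.PosSemidef} := by
  have := Fintype.ofFinite m
  simp only [posSemidef_iff_dotProduct_mulVec, Set.ofPred_and, Set.ofPred_forall]
  refine (isClosed_eq continuous_id.matrix_conjTranspose continuous_id).inter
    (isClosed_iInter fun x => isClosed_le continuous_const ?_)
  exact Continuous.dotProduct continuous_const (continuous_id.matrix_mulVec continuous_const)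

instance orderClosedTopology_matrix {m : Type*} [Finite m] : OrderClosedTopology (Matrix m m ℝ) :=
  ⟨isClosed_setOf_posSemidef.preimage (continuous_snd.sub continuous_fst)⟩

theorem dotProduct_self_eq_norm_sq (x : m → ℝ) : x ⬝ᵥ x = ‖WithLp.toLp 2 x‖ ^ 2 := by
  rw [EuclideanSpace.real_norm_sq_eq]
  simp [dotProduct, pow_two]

theorem dotProduct_conjTranspose_mul_self_mulVec {l : Type*} [Fintype l] (S : Matrix l m ℝ)
    (x : m → ℝ) : x ⬝ᵥ (Sᴴ * S) *ᵥ x = ‖WithLp.toLp 2 (S *ᵥ x)‖ ^ 2 := by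
  rw [← dotProduct_self_eq_norm_sq, ← mulVec_mulVec, dotProduct_mulVec,
    conjTranspose_eq_transpose_of_trivial, vecMul_transpose]

theorem dotProduct_mulVec_le_norm_mul [DecidableEq m] (X : Matrix m m ℝ) (x : EuclideanSpace ℝ m) :
    x.ofLp ⬝ᵥ X *ᵥ x.ofLp ≤ ‖X‖ * ‖x‖ ^ 2 :=
  calc x.ofLp ⬝ᵥ X *ᵥ x.ofLp = inner ℝ (X.toEuclideanLin x) x := rfl
    _ ≤ ‖X.toEuclideanLin x‖ * ‖x‖ := real_inner_le_norm _ _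
    _ ≤ ‖X‖ * ‖x‖ * ‖x‖ := by gcongr; exact X.l2_opNorm_mulVec x
    _ = ‖X‖ * ‖x‖ ^ 2 := by ring

theorem norm_le_of_dotProduct_mulVec_le [DecidableEq m] {X : Matrix m m ℝ} (hX : X.PosSemidef)
    {b : ℝ} (hb : 0 ≤ b) (h : ∀ x : EuclideanSpace ℝ m, x.ofLp ⬝ᵥ X *ᵥ x.ofLp ≤ b * ‖x‖ ^ 2) :
    ‖X‖ ≤ b := by
  obtain ⟨S, rfl⟩ := CStarAlgebra.nonneg_iff_eq_star_mul_self.mp hX.nonneg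
  have hS : ‖S‖ ≤ √b := by
    refine ContinuousLinearMap.opNorm_le_bound _ (Real.sqrt_nonneg b) fun x => ?_
    refine le_of_sq_le_sq ?_ (by positivity)
    rw [mul_pow, Real.sq_sqrt hb]
    exact (dotProduct_conjTranspose_mul_self_mulVec S x.ofLp).symm.trans_le (h x)
  calc ‖star S * S‖ = ‖S‖ * ‖S‖ := CStarRing.norm_star_mul_self
    _ ≤ √b * √b := by gcongr
    _ = b := Real.mul_self_sqrt hb

theorem exists_dotProduct_mulVec_le_mul_of_posDef {Y : Matrix m m ℝ} (hY : Y.PosDef)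
    (X : Matrix m m ℝ) : ∃ C : ℝ, 1 ≤ C ∧ ∀ x, x ⬝ᵥ X *ᵥ x ≤ C * x ⬝ᵥ Y *ᵥ x := by
  classical
  obtain ⟨S, hS, rfl⟩ :=
    CStarAlgebra.isStrictlyPositive_iff_eq_star_mul_self.mp hY.isStrictlyPositive
  refine ⟨1 + ‖X‖ * ‖S⁻¹‖ ^ 2, le_add_of_nonneg_right (by positivity), fun x => ?_⟩
  have hx : ‖WithLp.toLp 2 x‖ ≤ ‖S⁻¹‖ * ‖WithLp.toLp 2 (S *ᵥ x)‖ := by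
    have h := S⁻¹.l2_opNorm_mulVec (WithLp.toLp 2 (S *ᵥ x))
    simpa [mulVec_mulVec, nonsing_inv_mul _ ((isUnit_iff_isUnit_det S).mp hS)] using h
  calc x ⬝ᵥ X *ᵥ x ≤ ‖X‖ * ‖WithLp.toLp 2 x‖ ^ 2 := dotProduct_mulVec_le_norm_mul X _
    _ ≤ ‖X‖ * (‖S⁻¹‖ * ‖WithLp.toLp 2 (S *ᵥ x)‖) ^ 2 := by gcongr
    _ ≤ (1 + ‖X‖ * ‖S⁻¹‖ ^ 2) * ‖WithLp.toLp 2 (S *ᵥ x)‖ ^ 2 := by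
      nlinarith [sq_nonneg ‖WithLp.toLp 2 (S *ᵥ x)‖]
    _ = _ := by rw [star_eq_conjTranspose, dotProduct_conjTranspose_mul_self_mulVec]

end LoewnerOrder

section MonotoneFixedPoint

open Filter Topology

theorem exists_isFixedPt_of_monotone_iterate_of_norm_le {E : Type*} [NormedAddCommGroup E]
    [ProperSpace E] [PartialOrder E] [OrderClosedTopology E] {f : E → E} {x : E} {b : ℝ}
    (hmono : Monotone fun N => f^[N] x) (hb : ∀ N, ‖f^[N] x‖ ≤ b)
    (hf : ∀ y, x ≤ y → ContinuousAt f y) : ∃ y, Function.IsFixedPt f y ∧ x ≤ y ∧ ‖y‖ ≤ b := by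
  obtain ⟨y, -, φ, hφ, hy⟩ := tendsto_subseq_of_bounded (Metric.isBounded_closedBall (x := 0))
    fun N => mem_closedBall_zero_iff.mpr (hb N)
  have hxy : x ≤ y := ge_of_tendsto' hy fun j => hmono (Nat.zero_le (φ j))
  have hfy : Tendsto (fun j => f^[φ j + 1] x) atTop (𝓝 (f y)) := by
    simpa only [Function.comp_def, Function.iterate_succ_apply'] using (hf y hxy).tendsto.comp hy
  have hle : f y ≤ y :=
    le_of_tendsto_of_tendsto' hfy (hy.comp (tendsto_add_atTop_nat 1))
      fun j => hmono (hφ (Nat.lt_succ_self j))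
  have hge : y ≤ f y := le_of_tendsto_of_tendsto' hy hfy fun j => hmono (Nat.le_succ (φ j))
  exact ⟨y, hle.antisymm hge, hxy, le_of_tendsto' hy.norm fun j => hb (φ j)⟩

end MonotoneFixedPoint

section Riccati

open Matrix Filter Topology

open scoped MatrixOrder

theorem mulVec_dotProduct_mulVec_mulVec {k l m o : Type*} [Fintype k] [Fintype l] [Fintype m]
    [Fintype o] {α : Type*} [CommSemiring α] (X : Matrix k l α) (Y : Matrix k m α)
    (Z : Matrix m o α) (x : l → α) (z : o → α) :
    (X *ᵥ x) ⬝ᵥ Y *ᵥ (Z *ᵥ z) = x ⬝ᵥ (Xᵀ * Y * Z) *ᵥ z := by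
  rw [← vecMul_transpose, ← dotProduct_mulVec, mulVec_mulVec, mulVec_mulVec, Matrix.mul_assoc]

variable {n p : ℕ} {A : Matrix (Fin n) (Fin n) ℝ} {B : Matrix (Fin n) (Fin p) ℝ}
  {Q : Matrix (Fin n) (Fin n) ℝ} {R : Matrix (Fin p) (Fin p) ℝ} {P P' : Matrix (Fin n) (Fin n) ℝ}

/-- The one-step cost of the state `x` and the control `u` in the linear-quadratic regulator
problem. -/
def lqCost (Q : Matrix (Fin n) (Fin n) ℝ) (R : Matrix (Fin p) (Fin p) ℝ) (x : Fin n → ℝ)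
    (u : Fin p → ℝ) : ℝ :=
  x ⬝ᵥ Q *ᵥ x + u ⬝ᵥ R *ᵥ u

/-- The feedback gain `K` of the Riccati equation: the control `-K x` minimizes the one-step cost
plus the quadratic form of `P` at the next state. -/
noncomputable def riccatiGain (A : Matrix (Fin n) (Fin n) ℝ) (B : Matrix (Fin n) (Fin p) ℝ)
    (R : Matrix (Fin p) (Fin p) ℝ) (P : Matrix (Fin n) (Fin n) ℝ) : Matrix (Fin p) (Fin n) ℝ :=
  (Bᵀ * P * B + R)⁻¹ * (Bᵀ * P * A)

theorem dotProduct_mulVec_self_le_lqCost (hR : R.PosSemidef) (x : Fin n → ℝ) (u : Fin p → ℝ) :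
    x ⬝ᵥ Q *ᵥ x ≤ lqCost Q R x u :=
  le_add_of_nonneg_right (hR.dotProduct_mulVec_nonneg u)

theorem lqCost_le (Q : Matrix (Fin n) (Fin n) ℝ) (R : Matrix (Fin p) (Fin p) ℝ)
    {x : EuclideanSpace ℝ (Fin n)} {u : EuclideanSpace ℝ (Fin p)} {b : ℝ} (hx : ‖x‖ ≤ b)
    (hu : ‖u‖ ≤ b) : lqCost Q R x u ≤ (‖Q‖ + ‖R‖) * b ^ 2 := by
  rw [add_mul]
  refine add_le_add ((dotProduct_mulVec_le_norm_mul Q x).trans ?_)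
    ((dotProduct_mulVec_le_norm_mul R u).trans ?_) <;> gcongr

theorem posDef_transpose_mul_mul_add (hP : P.PosSemidef) (hR : R.PosDef) :
    (Bᵀ * P * B + R).PosDef := by
  simpa using hR.posSemidef_add (hP.conjTranspose_mul_mul_same B)

theorem lqCost_add_dotProduct_eq (hP : P.PosSemidef) (hR : R.PosDef) (x : Fin n → ℝ)
    (u : Fin p → ℝ) :
    lqCost Q R x u + (A *ᵥ x + B *ᵥ u) ⬝ᵥ P *ᵥ (A *ᵥ x + B *ᵥ u) =
      x ⬝ᵥ riccatiMap A B Q R P *ᵥ x +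
        (riccatiGain A B R P *ᵥ x + u) ⬝ᵥ (Bᵀ * P * B + R) *ᵥ (riccatiGain A B R P *ᵥ x + u) := by
  have hS := posDef_transpose_mul_mul_add (B := B) hP hR
  have := hS.isUnit.invertible
  have hPt : Pᵀ = P := by simpa using hP.isHermitian.eq
  have hcross : (Aᵀ * P * B)ᴴ = Bᵀ * P * A := by simp [hPt, Matrix.mul_assoc]
  have h := schur_complement_eq₂₂ (Aᵀ * P * A + Q) (Aᵀ * P * B) x u hS.isHermitian
  rw [hcross] at h
  simp only [star_trivial, ← dotProduct_mulVec, fromBlocks_mulVec, sumElim_dotProduct_sumElim,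
    Sum.elim_comp_inl, Sum.elim_comp_inr] at h
  rw [lqCost, riccatiGain, riccatiMap]
  simp only [mulVec_add, add_dotProduct, dotProduct_add, add_mulVec,
    mulVec_dotProduct_mulVec_mulVec, ← Matrix.mul_assoc] at h ⊢
  linarith

theorem dotProduct_riccatiMap_mulVec_le (hP : P.PosSemidef) (hR : R.PosDef) (x : Fin n → ℝ)
    (u : Fin p → ℝ) :
    x ⬝ᵥ riccatiMap A B Q R P *ᵥ x ≤
      lqCost Q R x u + (A *ᵥ x + B *ᵥ u) ⬝ᵥ P *ᵥ (A *ᵥ x + B *ᵥ u) := by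
  rw [lqCost_add_dotProduct_eq hP hR]
  exact le_add_of_nonneg_right
    ((posDef_transpose_mul_mul_add hP hR).posSemidef.dotProduct_mulVec_nonneg _)

theorem dotProduct_riccatiMap_mulVec_eq (hP : P.PosSemidef) (hR : R.PosDef) (x : Fin n → ℝ) :
    x ⬝ᵥ riccatiMap A B Q R P *ᵥ x = lqCost Q R x (-(riccatiGain A B R P *ᵥ x)) +
      (A *ᵥ x + B *ᵥ -(riccatiGain A B R P *ᵥ x)) ⬝ᵥ
        P *ᵥ (A *ᵥ x + B *ᵥ -(riccatiGain A B R P *ᵥ x)) := by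
  rw [lqCost_add_dotProduct_eq hP hR]
  simp

theorem isHermitian_riccatiMap (hQ : Q.IsHermitian) (hR : R.IsHermitian) (hP : P.IsHermitian) :
    (riccatiMap A B Q R P).IsHermitian := by
  have hS : (Bᵀ * P * B + R).IsHermitian := by
    simpa using (isHermitian_conjTranspose_mul_mul B hP).add hR
  have h := ((isHermitian_conjTranspose_mul_mul A hP).add hQ).sub
    (isHermitian_conjTranspose_mul_mul (Bᵀ * P * A) hS.inv)
  have hPt : Pᵀ = P := by simpa using hP.eq
  simpa [riccatiMap, hPt, Matrix.mul_assoc] using h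

theorem le_riccatiMap (hQ : Q.IsHermitian) (hR : R.PosDef) (hP : P.PosSemidef) :
    Q ≤ riccatiMap A B Q R P := by
  rw [le_iff_dotProduct_mulVec_le hQ (isHermitian_riccatiMap hQ hR.isHermitian hP.isHermitian)]
  intro x
  rw [dotProduct_riccatiMap_mulVec_eq hP hR]
  exact (dotProduct_mulVec_self_le_lqCost hR.posSemidef x _).trans
    (le_add_of_nonneg_right (hP.dotProduct_mulVec_nonneg _))

theorem posSemidef_riccatiMap (hQ : Q.PosSemidef) (hR : R.PosDef) (hP : P.PosSemidef) :
    (riccatiMap A B Q R P).PosSemidef :=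
  nonneg_iff_posSemidef.mp (hQ.nonneg.trans (le_riccatiMap hQ.isHermitian hR hP))

theorem riccatiMap_mono (hQ : Q.IsHermitian) (hR : R.PosDef) (hP : P.PosSemidef) (h : P ≤ P') :
    riccatiMap A B Q R P ≤ riccatiMap A B Q R P' := by
  have hP' : P'.PosSemidef := nonneg_iff_posSemidef.mp (hP.nonneg.trans h)
  rw [le_iff_dotProduct_mulVec_le (isHermitian_riccatiMap hQ hR.isHermitian hP.isHermitian)
    (isHermitian_riccatiMap hQ hR.isHermitian hP'.isHermitian)]
  intro x
  rw [dotProduct_riccatiMap_mulVec_eq hP' hR]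
  exact (dotProduct_riccatiMap_mulVec_le hP hR x _).trans
    (add_le_add_right (dotProduct_mulVec_mono h _) _)

theorem posSemidef_iterate_riccatiMap (hQ : Q.PosSemidef) (hR : R.PosDef) (hP : P.PosSemidef)
    (N : ℕ) : ((riccatiMap A B Q R)^[N] P).PosSemidef :=
  Function.Iterate.rec PosSemidef hP (fun _ => posSemidef_riccatiMap hQ hR) N

theorem monotone_iterate_riccatiMap (hQ : Q.PosSemidef) (hR : R.PosDef) :
    Monotone fun N => (riccatiMap A B Q R)^[N] Q := by
  refine monotone_nat_of_le_succ fun N => ?_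
  induction N with
  | zero => exact le_riccatiMap hQ.isHermitian hR hQ
  | succ N ih =>
    simpa only [Function.iterate_succ_apply'] using
      riccatiMap_mono hQ.isHermitian hR (posSemidef_iterate_riccatiMap hQ hR hQ N) ih

theorem continuousAt_riccatiMap (hR : R.PosDef) (hP : P.PosSemidef) :
    ContinuousAt (riccatiMap A B Q R) P := by
  have hdet := (isUnit_iff_isUnit_det _).mp (posDef_transpose_mul_mul_add (B := B) hP hR).isUnit
  have hdet_inv : ContinuousAt Ring.inverse (Bᵀ * P * B + R).det := by
    rw [Ring.inverse_eq_inv']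
    exact continuousAt_inv₀ hdet.ne_zero
  have hS : Continuous fun P : Matrix (Fin n) (Fin n) ℝ => Bᵀ * P * B + R := by fun_prop
  have hinv : ContinuousAt (fun P : Matrix (Fin n) (Fin n) ℝ => (Bᵀ * P * B + R)⁻¹) P :=
    ContinuousAt.comp (x := P) (f := fun P => Bᵀ * P * B + R)
      (continuousAt_matrix_inv _ hdet_inv) hS.continuousAt
  have hpair : Continuous fun X : Matrix (Fin n) (Fin n) ℝ × Matrix (Fin p) (Fin p) ℝ =>
      Aᵀ * X.1 * A + Q - Aᵀ * X.1 * B * X.2 * Bᵀ * X.1 * A := by fun_prop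
  exact ContinuousAt.comp (x := P)
    (f := fun P : Matrix (Fin n) (Fin n) ℝ => (P, (Bᵀ * P * B + R)⁻¹))
    hpair.continuousAt (continuousAt_id.prodMk hinv)

theorem dotProduct_iterate_riccatiMap_mulVec_le (hQ : Q.PosSemidef) (hR : R.PosDef)
    (hP : P.PosSemidef) {x : ℕ → Fin n → ℝ} {u : ℕ → Fin p → ℝ}
    (hx : ∀ k, x (k + 1) = A *ᵥ x k + B *ᵥ u k) (N : ℕ) :
    x 0 ⬝ᵥ (riccatiMap A B Q R)^[N] P *ᵥ x 0 ≤
      ∑ k ∈ Finset.range N, lqCost Q R (x k) (u k) + x N ⬝ᵥ P *ᵥ x N := by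
  induction N generalizing x u with
  | zero => simp
  | succ N ih =>
    rw [Function.iterate_succ_apply', Finset.sum_range_succ', add_right_comm]
    have h := ih (x := fun k => x (k + 1)) (u := fun k => u (k + 1)) fun k => hx (k + 1)
    have hstep := dotProduct_riccatiMap_mulVec_le (A := A) (B := B) (Q := Q)
      (posSemidef_iterate_riccatiMap (A := A) (B := B) hQ hR hP N) hR (x 0) (u 0)
    rw [← hx] at hstep
    linarith

theorem IsRiccatiDifferenceSolution.apply_zero {T : ℕ} {P : ℕ → Matrix (Fin n) (Fin n) ℝ}
    (h : IsRiccatiDifferenceSolution A B Q R T P) : P 0 = (riccatiMap A B Q R)^[T] Q := by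
  suffices ∀ t ≤ T, P (T - t) = (riccatiMap A B Q R)^[t] Q by simpa using this T le_rfl
  intro t ht
  induction t with
  | zero => exact h.1
  | succ t ih =>
    rw [Function.iterate_succ_apply', ← ih (by lia), ← h.2 (T - t) (by lia) (by lia), Nat.sub_sub]

theorem dotProduct_mulVec_closedLoop_le (hR : R.PosDef) (hP : P.PosSemidef)
    (hPle : riccatiMap A B Q R P ≤ P) {C : ℝ} (hC : 1 ≤ C)
    (hPQ : ∀ x, x ⬝ᵥ P *ᵥ x ≤ C * x ⬝ᵥ Q *ᵥ x) (x : Fin n → ℝ) :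
    (A *ᵥ x + B *ᵥ -(riccatiGain A B R P *ᵥ x)) ⬝ᵥ
      P *ᵥ (A *ᵥ x + B *ᵥ -(riccatiGain A B R P *ᵥ x)) ≤ (1 - C⁻¹) * x ⬝ᵥ P *ᵥ x := by
  have hstep := dotProduct_riccatiMap_mulVec_eq (A := A) (B := B) (Q := Q) hP hR x
  have hcost := dotProduct_mulVec_self_le_lqCost (Q := Q) hR.posSemidef x
    (-(riccatiGain A B R P *ᵥ x))
  have hdecay : C⁻¹ * x ⬝ᵥ P *ᵥ x ≤ x ⬝ᵥ Q *ᵥ x := by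
    rw [inv_mul_le_iff₀ (by positivity)]
    exact hPQ x
  linarith [dotProduct_mulVec_mono hPle x]

theorem dotProduct_mulVec_sub_le_pow_mul (hR : R.PosDef) (hP : P.PosSemidef)
    (hP' : P'.PosSemidef) (h : P ≤ riccatiMap A B Q R P) (h' : riccatiMap A B Q R P' ≤ P')
    {D θ : ℝ} (hD : 0 ≤ D) (hθ : 0 ≤ θ) (hPP' : ∀ x, x ⬝ᵥ P *ᵥ x ≤ D * x ⬝ᵥ P' *ᵥ x)
    (hloop : ∀ x, (A *ᵥ x + B *ᵥ -(riccatiGain A B R P' *ᵥ x)) ⬝ᵥ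
      P' *ᵥ (A *ᵥ x + B *ᵥ -(riccatiGain A B R P' *ᵥ x)) ≤ θ * x ⬝ᵥ P' *ᵥ x)
    (N : ℕ) (x : Fin n → ℝ) :
    x ⬝ᵥ P *ᵥ x - x ⬝ᵥ P' *ᵥ x ≤ D * θ ^ N * x ⬝ᵥ P' *ᵥ x := by
  induction N generalizing x with
  | zero =>
    have : 0 ≤ x ⬝ᵥ P' *ᵥ x := hP'.dotProduct_mulVec_nonneg x
    linarith [hPP' x]
  | succ N ih =>
    set u := -(riccatiGain A B R P' *ᵥ x)
    calc x ⬝ᵥ P *ᵥ x - x ⬝ᵥ P' *ᵥ x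
        ≤ (A *ᵥ x + B *ᵥ u) ⬝ᵥ P *ᵥ (A *ᵥ x + B *ᵥ u) -
            (A *ᵥ x + B *ᵥ u) ⬝ᵥ P' *ᵥ (A *ᵥ x + B *ᵥ u) := by
          have hstep := (dotProduct_mulVec_mono h x).trans
            (dotProduct_riccatiMap_mulVec_le hP hR x u)
          have hstep' := (dotProduct_riccatiMap_mulVec_eq hP' hR x).symm.trans_le
            (dotProduct_mulVec_mono h' x)
          linarith
      _ ≤ D * θ ^ N * (A *ᵥ x + B *ᵥ u) ⬝ᵥ P' *ᵥ (A *ᵥ x + B *ᵥ u) := ih _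
      _ ≤ D * θ ^ N * (θ * x ⬝ᵥ P' *ᵥ x) := by gcongr; exact hloop x
      _ = D * θ ^ (N + 1) * x ⬝ᵥ P' *ᵥ x := by ring

theorem le_of_le_riccatiMap_of_riccatiMap_le (hQ : Q.PosDef) (hR : R.PosDef) (hP : P.PosSemidef)
    (hP' : P'.PosDef) (h : P ≤ riccatiMap A B Q R P) (h' : riccatiMap A B Q R P' ≤ P') :
    P ≤ P' := by
  rw [le_iff_dotProduct_mulVec_le hP.isHermitian hP'.isHermitian]
  intro x
  obtain ⟨C, hC, hCQ⟩ := exists_dotProduct_mulVec_le_mul_of_posDef hQ P'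
  obtain ⟨D, hD, hDP⟩ := exists_dotProduct_mulVec_le_mul_of_posDef hP' P
  have hθ : 0 ≤ 1 - C⁻¹ := sub_nonneg.mpr (inv_le_one_of_one_le₀ hC)
  have hθ' : 1 - C⁻¹ < 1 := sub_lt_self _ (by positivity)
  have hgap (N : ℕ) := dotProduct_mulVec_sub_le_pow_mul hR hP hP'.posSemidef h h' (by positivity)
    hθ hDP (dotProduct_mulVec_closedLoop_le hR hP'.posSemidef h' hC hCQ) N x
  have hlim : Tendsto (fun N : ℕ => D * (1 - C⁻¹) ^ N * x ⬝ᵥ P' *ᵥ x) atTop (𝓝 0) := by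
    simpa using ((tendsto_pow_atTop_nhds_zero_of_lt_one hθ hθ').const_mul D).mul_const
      (x ⬝ᵥ P' *ᵥ x)
  exact sub_nonpos.mp (ge_of_tendsto' hlim hgap)

theorem IsPosDefRiccatiSolution.unique (hQ : Q.PosDef) (hR : R.PosDef)
    (h : IsPosDefRiccatiSolution A B Q R P) (h' : IsPosDefRiccatiSolution A B Q R P') : P = P' :=
  le_antisymm
    (le_of_le_riccatiMap_of_riccatiMap_le hQ hR h.1.posSemidef h'.1 h.2.le h'.2.symm.le)
    (le_of_le_riccatiMap_of_riccatiMap_le hQ hR h'.1.posSemidef h.1 h'.2.le h.2.symm.le)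

theorem riccatiBoundedBy_of_norm_iterate_le (hQ : Q.PosSemidef) (hR : R.PosDef) (κ : ℕ) {b : ℝ}
    (hb : ∀ N, ‖(riccatiMap A B Q R)^[N] Q‖ ≤ b) : RiccatiBoundedBy A B Q R κ b := by
  refine ⟨fun T _ P hP => hP.apply_zero ▸ hb T, fun hQ' => ?_⟩
  have := FiniteDimensional.proper ℝ (Matrix (Fin n) (Fin n) ℝ)
  obtain ⟨P, hfix, hQP, hPb⟩ := exists_isFixedPt_of_monotone_iterate_of_norm_le
    (monotone_iterate_riccatiMap (A := A) (B := B) hQ hR) hb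
    fun P hP => continuousAt_riccatiMap hR (nonneg_iff_posSemidef.mp (hQ.nonneg.trans hP))
  have hPsol : IsPosDefRiccatiSolution A B Q R P :=
    ⟨by simpa using hQ'.add_posSemidef (Matrix.le_iff.mp hQP), hfix.eq.symm⟩
  exact ⟨P, hPsol, fun P' hP' => hP'.unique hQ' hR hPsol, hPb⟩

end Riccati

theorem exists_linearIsometryEquiv_eq_toEuclideanLin {m : Type*} [Fintype m] [DecidableEq m]
    {U : Matrix m m ℝ} (hU : U ∈ Matrix.orthogonalGroup m ℝ) :
    ∃ e : EuclideanSpace ℝ m ≃ₗᵢ[ℝ] EuclideanSpace ℝ m, ∀ x, e x = U.toEuclideanLin x :=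
  ⟨Unitary.linearIsometryEquiv ⟨Matrix.toEuclideanCLM (n := m) (𝕜 := ℝ) U,
    Unitary.map_mem Matrix.toEuclideanCLM hU⟩, fun _ => rfl⟩

theorem norm_transpose_mul_of_mem_orthogonalGroup {m l : Type*} [Fintype m] [DecidableEq m]
    [Fintype l] [DecidableEq l] {U : Matrix m m ℝ} (hU : U ∈ Matrix.orthogonalGroup m ℝ)
    (X : Matrix m l ℝ) : ‖Uᵀ * X‖ = ‖X‖ := by
  have hUU : U * Uᵀ = 1 := Unitary.mul_star_self_of_mem hU
  rw [← mul_self_inj (norm_nonneg _) (norm_nonneg _), ← Matrix.l2_opNorm_conjTranspose_mul_self,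
    ← Matrix.l2_opNorm_conjTranspose_mul_self, Matrix.conjTranspose_eq_transpose_of_trivial,
    Matrix.conjTranspose_eq_transpose_of_trivial, Matrix.transpose_mul, Matrix.transpose_transpose,
    Matrix.mul_assoc, ← Matrix.mul_assoc U, hUU, Matrix.one_mul]

section Robust

variable {n p : ℕ} {A : Matrix (Fin n) (Fin n) ℝ} {B : Matrix (Fin n) (Fin p) ℝ} {M μ : ℝ}

theorem IsRobustlyCoupled.le_norm_input (h : IsRobustlyCoupled A B μ) : μ ≤ ‖B‖ := by
  obtain ⟨-, -, U, hU, hBU, -⟩ := h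
  exact hBU.trans ((singularValue_submatrix_id_le_norm _ Subtype.val_injective p).trans_eq
    (norm_transpose_mul_of_mem_orthogonalGroup hU.orthogonal B))

theorem IsRobustlyCoupled.one_le_ratio (h : IsRobustlyCoupled A B μ) (hB : ‖B‖ ≤ M) :
    1 ≤ M / μ :=
  (one_le_div h.1).mpr (h.le_norm_input.trans hB)

theorem IsRobustlyCoupled.hasDeadbeatControl (h : IsRobustlyCoupled A B μ) (hM : 1 ≤ M)
    (hA : ‖A‖ ≤ M) (hB : ‖B‖ ≤ M) :
    HasDeadbeatControl A.toEuclideanLin B.toEuclideanLin (controllabilityIndex A B)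
      (2 * (M / μ) * (3 * (M / μ) * M) ^ controllabilityIndex A B) := by
  have hμM : μ ≤ M := h.le_norm_input.trans hB
  obtain ⟨hμ, hc, U, hU, hBU, hAU⟩ := h
  have hUU : U * Uᵀ = 1 := Unitary.mul_star_self_of_mem hU.orthogonal
  have hA' : ‖Uᵀ * A * U‖ ≤ M := by
    rwa [CStarRing.norm_mul_mem_unitary _ hU.orthogonal,
      norm_transpose_mul_of_mem_orthogonalGroup hU.orthogonal]
  obtain ⟨e, he⟩ := exists_linearIsometryEquiv_eq_toEuclideanLin (Unitary.star_mem hU.orthogonal)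
  have hdeadbeat := (hU.isCoupledFlag hc hμ hBU hAU).hasDeadbeatControl hμ hμM hM fun x =>
    (norm_toEuclideanLin_le _ x).trans (by gcongr)
  refine hdeadbeat.of_linearIsometryEquiv e (fun x => ?_) fun u => ?_
  · simp only [he, Matrix.toLpLin_apply, Matrix.mulVec_mulVec, Matrix.mul_assoc]
    rw [Matrix.star_eq_conjTranspose, Matrix.conjTranspose_eq_transpose_of_trivial, hUU,
      Matrix.mul_one]
  · simp only [he, Matrix.toLpLin_apply, Matrix.mulVec_mulVec]
    rfl

end Robust

section Bounds

open Matrix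

variable {n p κ : ℕ} {A : Matrix (Fin n) (Fin n) ℝ} {B : Matrix (Fin n) (Fin p) ℝ}
  {Q : Matrix (Fin n) (Fin n) ℝ} {R : Matrix (Fin p) (Fin p) ℝ} {W M μ b b' : ℝ}

theorem HasDeadbeatControl.norm_iterate_riccatiMap_le
    (h : HasDeadbeatControl A.toEuclideanLin B.toEuclideanLin κ W) (hQ : Q.PosSemidef)
    (hR : R.PosDef) (N : ℕ) :
    ‖(riccatiMap A B Q R)^[N] Q‖ ≤ κ * ((‖Q‖ + ‖R‖) * W ^ 2) := by
  refine norm_le_of_dotProduct_mulVec_le (posSemidef_iterate_riccatiMap hQ hR hQ N)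
    (by positivity) fun x₀ => ?_
  obtain ⟨x, u, rfl, hx, hzero, hnorm⟩ := h x₀
  have hcost_zero : ∀ k, κ ≤ k → lqCost Q R (x k) (u k) = 0 := fun k hk => by
    simp [lqCost, (hzero k hk).1, (hzero k hk).2]
  have hcost_nonneg : ∀ k, 0 ≤ lqCost Q R (x k) (u k) := fun k =>
    (hQ.dotProduct_mulVec_nonneg (x k)).trans (dotProduct_mulVec_self_le_lqCost hR.posSemidef _ _)
  calc (x 0).ofLp ⬝ᵥ (riccatiMap A B Q R)^[N] Q *ᵥ (x 0).ofLp
      ≤ ∑ k ∈ Finset.range N, lqCost Q R (x k) (u k) + (x N).ofLp ⬝ᵥ Q *ᵥ (x N).ofLp :=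
        dotProduct_iterate_riccatiMap_mulVec_le hQ hR hQ (x := fun k => (x k).ofLp)
          (u := fun k => (u k).ofLp) (fun k => congrArg WithLp.ofLp (hx k)) N
    _ ≤ ∑ k ∈ Finset.range (N + 1), lqCost Q R (x k) (u k) := by
        rw [Finset.sum_range_succ]
        gcongr
        exact dotProduct_mulVec_self_le_lqCost hR.posSemidef _ _
    _ ≤ ∑ k ∈ Finset.range κ, lqCost Q R (x k) (u k) :=
        (Finset.sum_le_sum_of_subset_of_nonneg
          (Finset.range_subset_range.mpr (le_max_left (N + 1) κ)) fun k _ _ =>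
            hcost_nonneg k).trans
          (Finset.sum_subset (Finset.range_subset_range.mpr (le_max_right (N + 1) κ))
            fun k _ hk => hcost_zero k (by simpa using hk)).ge
    _ ≤ ∑ _k ∈ Finset.range κ, (‖Q‖ + ‖R‖) * (W * ‖x 0‖) ^ 2 :=
        Finset.sum_le_sum fun k _ => lqCost_le Q R (hnorm k).1 (hnorm k).2
    _ = κ * ((‖Q‖ + ‖R‖) * W ^ 2) * ‖x 0‖ ^ 2 := by
        rw [Finset.sum_const, Finset.card_range, nsmul_eq_mul]
        ring

theorem RiccatiBoundedBy.mono (h : RiccatiBoundedBy A B Q R κ b) (hb : b ≤ b') :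
    RiccatiBoundedBy A B Q R κ b' :=
  ⟨fun T hT P hP => (h.1 T hT P hP).trans hb, fun hQ =>
    let ⟨P, hP, huniq, hPb⟩ := h.2 hQ
    ⟨P, hP, huniq, hPb.trans hb⟩⟩

theorem sq_deadbeatGain_le {r : ℝ} (hr : 1 ≤ r) (hM : 0 ≤ M) (hκ : κ ≠ 0) :
    (2 * r * (3 * r * M) ^ κ) ^ 2 ≤ 36 ^ κ * ((r ^ κ) ^ 4 * (M ^ κ) ^ 2) :=
  calc (2 * r * (3 * r * M) ^ κ) ^ 2 ≤ ((2 * r) ^ κ * (3 * r * M) ^ κ) ^ 2 := by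
        gcongr
        exact le_self_pow₀ (by linarith) hκ
    _ = ((2 * r * (3 * r * M)) ^ 2) ^ κ := by rw [← mul_pow, ← pow_mul, ← pow_mul, mul_comm κ]
    _ = (36 * (r ^ 4 * M ^ 2)) ^ κ := by ring
    _ = 36 ^ κ * ((r ^ κ) ^ 4 * (M ^ κ) ^ 2) := by rw [mul_pow, mul_pow]; ring

/-- The bounding polynomial, whose variables stand in order for `(M / μ) ^ κ`, `M ^ κ`, `κ`, `‖Q‖`
and `‖R‖`. The exponent `m` leaves room to absorb a constant `C ^ κ`. -/
noncomputable def riccatiPolynomial (m : ℕ) : MvPolynomial (Fin 5) ℝ :=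
  MvPolynomial.X 2 * ((MvPolynomial.X 3 + MvPolynomial.X 4) *
    (MvPolynomial.X 0 ^ (4 + m) * MvPolynomial.X 1 ^ (2 + m)))

theorem eval_riccatiPolynomial (m : ℕ) (r M k q s : ℝ) :
    MvPolynomial.eval ![r, M, k, q, s] (riccatiPolynomial m) =
      k * ((q + s) * ((r * M) ^ m * (r ^ 4 * M ^ 2))) := by
  simp only [riccatiPolynomial, map_mul, map_add, map_pow, MvPolynomial.eval_X]
  simp only [Matrix.cons_val]
  ring

theorem IsRobustlyCoupled.riccatiBoundedBy_eval (h : IsRobustlyCoupled A B μ) (hM : 1 ≤ M)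
    (hA : ‖A‖ ≤ M) (hB : ‖B‖ ≤ M) (hQ : Q.PosSemidef) (hR : R.PosDef)
    (hκ : κ = controllabilityIndex A B) {r : ℝ} (hr : M / μ ≤ r) {m : ℕ}
    (hm : 36 ≤ (r * M) ^ m) :
    RiccatiBoundedBy A B Q R κ
      (MvPolynomial.eval ![r ^ κ, M ^ κ, (κ : ℝ), ‖Q‖, ‖R‖] (riccatiPolynomial m)) := by
  subst hκ
  have hdeadbeat := h.hasDeadbeatControl hM hA hB
  have hκ := Nat.one_le_iff_ne_zero.mp (controllabilityIndex_mem h.2.1).1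
  have hratio := h.one_le_ratio hB
  set κ := controllabilityIndex A B
  refine (riccatiBoundedBy_of_norm_iterate_le hQ hR κ fun N =>
    hdeadbeat.norm_iterate_riccatiMap_le hQ hR N).mono ?_
  rw [eval_riccatiPolynomial]
  gcongr
  calc (2 * (M / μ) * (3 * (M / μ) * M) ^ κ) ^ 2
      ≤ 36 ^ κ * (((M / μ) ^ κ) ^ 4 * (M ^ κ) ^ 2) :=
        sq_deadbeatGain_le hratio (zero_le_one.trans hM) hκ
    _ ≤ ((r * M) ^ m) ^ κ * ((r ^ κ) ^ 4 * (M ^ κ) ^ 2) := by gcongr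
    _ = (r ^ κ * M ^ κ) ^ m * ((r ^ κ) ^ 4 * (M ^ κ) ^ 2) := by
        rw [← mul_pow, pow_right_comm]

end Bounds

theorem mainTheorem7 (c : ℝ) (hc : 1 < c) :
    ∃ F : MvPolynomial (Fin 5) ℝ,
      ∀ (n p : ℕ) (A : Matrix (Fin n) (Fin n) ℝ) (B : Matrix (Fin n) (Fin p) ℝ)
        (Q : Matrix (Fin n) (Fin n) ℝ) (R : Matrix (Fin p) (Fin p) ℝ) (M μ : ℝ) (κ : ℕ),
        1 ≤ M → ‖A‖ ≤ M → ‖B‖ ≤ M →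
        IsControllablePair A B → κ = controllabilityIndex A B → IsRobustlyCoupled A B μ →
        Q.PosSemidef → R.PosDef →
        (c ≤ max M (M / μ) →
          RiccatiBoundedBy A B Q R κ
            (MvPolynomial.eval ![(M / μ) ^ κ, M ^ κ, (κ : ℝ), ‖Q‖, ‖R‖] F)) ∧
        RiccatiBoundedBy A B Q R κ
          (MvPolynomial.eval ![(c * M / μ) ^ κ, M ^ κ, (κ : ℝ), ‖Q‖, ‖R‖] F) := by
  obtain ⟨m, hm⟩ := pow_unbounded_of_one_lt 36 hc
  refine ⟨riccatiPolynomial m, fun n p A B Q R M μ κ hM hA hB _ hκ h hQ hR => ?_⟩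
  have hr : 1 ≤ M / μ := h.one_le_ratio hB
  have hbound {r : ℝ} (hMr : M / μ ≤ r) (hcr : c ≤ r * M) :=
    h.riccatiBoundedBy_eval hM hA hB hQ hR hκ hMr
      (hm.le.trans (pow_le_pow_left₀ (by linarith) hcr m))
  refine ⟨fun hmax => hbound le_rfl (hmax.trans (max_le ?_ ?_)), ?_⟩
  · exact le_mul_of_one_le_left (by linarith) hr
  · exact le_mul_of_one_le_right (by linarith) hM
  · rw [mul_div_assoc]
    exact hbound (le_mul_of_one_le_left (by linarith) hc.le)
      ((le_mul_of_one_le_right (by linarith) hr).trans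
        (le_mul_of_one_le_right (by positivity) hM))
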